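/- Notation. For a field $F$, let $\bigwedge^2F^*$ be the quotient of $F^*\otimes_{\mathbb Z}F^*$ by the subgroup generated by all $x\otimes y+y\otimes x$, and write $x\wedge y$ for the class of $x\otimes y$. Let $\mathcal P(F)$ be the quotient of the free abelian group on $F\setminus\{0,1\}$ by the five-term relations $$[x]-[y]+\left[\tfrac{y}{x}\right]-\left[\tfrac{1-x^{-1}}{1-y^{-1}}\right]+\left[\tfrac{1-x}{1-y}\right],\qquad x\neq y\in F\setminus\{0,1\},$$ and let $\mathcal B(F)$ be the kernel of the homomorphism $\delta:\mathcal P(F)\to\bigwedge^2F^*$, $\delta([z])=z\wedge(1-z)$. Let $M=\mathbb H^3/\Gamma$ be an oriented complete hyperbolic 3-manifold of finite volume, where $\Gamma\subset PSL(2,\mathbb C)$ is discrete and torsion-free, and let $\hat M$ be the space obtained from $M$ by adding one point for each cusp (equivalently, by collapsing each boundary component of the compact manifold with interior $M$). Let $T$ be a finite ideal triangulation of $M$, that is, a singular triangulation of $\hat M$ by finitely many tetrahedra $T_i$, glued along their faces (self-gluings are allowed), whose vertices are exactly the added points. The vertices of each $T_i$ are ordered compatibly with one fixed orientation of all the tetrahedra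 (the face gluings reverse orientation). Lift each $T_i$ to $\mathbb H^3$ together with the cusps (the fixed points in $\mathbb CP^1$ of parabolic elements of $\Gamma$), so that glued faces correspond under elements of $\Gamma$ (the side pairings). Let $p^i_0,p^i_1,p^i_2,p^i_3\in\mathbb CP^1$ be the vertices of the lift of $T_i$, and suppose that for each $i$ these four points are distinct. Let $$z_i=\frac{[v_2,v_0]\,[v_3,v_1]}{[v_3,v_0]\,[v_2,v_1]}\in\mathbb C\setminus\{0,1\}$$ be their cross-ratio, where $v_k\in\mathbb C^2$ represents $p^i_k$ and $[v,w]$ is the determinant of the pair $(v,w)$ (so $z_i$ is the cross-ratio that is $z$ for the points $\infty,0,1,z$), and let $\beta(T)=\sum_i[z_i]\in\mathcal P(\mathbb C)$. Theorem (Bloch identity, real hyperbolic case). In $\bigwedge^2\mathbb C^*$, $$\delta(\beta(T))=\sum_i z_i\wedge(1-z_i)=0,$$ so that $\beta(T)\in\mathcal B(\mathbb C)$. -/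

import Mathlib

open scoped TensorProduct LinearAlgebra.Projectivization ENNReal ComplexOrder

noncomputable section

namespace BlochHyp

/-! ### The pre-Bloch group and the Bloch group of a field -/

section Bloch

variable (F : Type*) [Field F]

/-- The subgroup of `Fˣ ⊗ Fˣ` generated by the elements `x ⊗ y + y ⊗ x`. -/
def symSubgroup : AddSubgroup (Additive Fˣ ⊗[ℤ] Additive Fˣ) :=
  AddSubgroup.closure {t | ∃ x y : Additive Fˣ, t = x ⊗ₜ[ℤ] y + y ⊗ₜ[ℤ] x}

/-- `∧² Fˣ`, the quotient of `Fˣ ⊗ Fˣ` by the elements `x ⊗ y + y ⊗ x` (written additively;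
`x ∧ x = 0` is not imposed). -/
abbrev ExtSq : Type _ := (Additive Fˣ ⊗[ℤ] Additive Fˣ) ⧸ symSubgroup F

/-- The generators `F ∖ {0, 1}` of the pre-Bloch group. -/
abbrev Param : Type _ := {z : F // z ≠ 0 ∧ z ≠ 1}

variable {F}

/-- The class `x ∧ y` of `x ⊗ y` in `∧² Fˣ`. -/
def wedge (x y : Fˣ) : ExtSq F :=
  QuotientAddGroup.mk (Additive.ofMul x ⊗ₜ[ℤ] Additive.ofMul y)

theorem wedge_mul_left (x y z : Fˣ) : wedge (x * y) z = wedge x z + wedge y z := by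
  simp only [wedge, ofMul_mul, TensorProduct.add_tmul, QuotientAddGroup.mk_add]

theorem wedge_mul_right (x y z : Fˣ) : wedge x (y * z) = wedge x y + wedge x z := by
  simp only [wedge, ofMul_mul, TensorProduct.tmul_add, QuotientAddGroup.mk_add]

theorem wedge_div_left (x y z : Fˣ) : wedge (x / y) z = wedge x z - wedge y z := by
  have := wedge_mul_left (x / y) y z
  rw [div_mul_cancel] at this
  rw [this, add_sub_cancel_right]

theorem wedge_div_right (x y z : Fˣ) : wedge x (y / z) = wedge x y - wedge x z := by
  have := wedge_mul_right x (y / z) z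
  rw [div_mul_cancel] at this
  rw [this, add_sub_cancel_right]

theorem wedge_add_swap (x y : Fˣ) : wedge x y + wedge y x = 0 := by
  rw [wedge, wedge, ← QuotientAddGroup.mk_add, QuotientAddGroup.eq_zero_iff]
  exact AddSubgroup.subset_closure ⟨_, _, rfl⟩

/-- `z` as an element of `Fˣ`. -/
def Param.unit (z : Param F) : Fˣ := Units.mk0 z.1 z.2.1

/-- `1 - z` as an element of `Fˣ`. -/
def Param.oneSub (z : Param F) : Fˣ := Units.mk0 (1 - z.1) (sub_ne_zero.2 z.2.2.symm)

variable (F)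

/-- The subgroup of `ℤ[F ∖ {0, 1}]` generated by the five-term relations
`[x] - [y] + [y/x] - [(1 - x⁻¹)/(1 - y⁻¹)] + [(1 - x)/(1 - y)]`, for all `x`, `y` in `F ∖ {0, 1}`
for which the five terms are in `F ∖ {0, 1}` (that is, `x ≠ y`). -/
def fiveTerm : AddSubgroup (FreeAbelianGroup (Param F)) :=
  AddSubgroup.closure {r | ∃ x y a b c : Param F,
    a.1 = y.1 / x.1 ∧ b.1 = (1 - x.1⁻¹) / (1 - y.1⁻¹) ∧ c.1 = (1 - x.1) / (1 - y.1) ∧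
    r = FreeAbelianGroup.of x - FreeAbelianGroup.of y + FreeAbelianGroup.of a
      - FreeAbelianGroup.of b + FreeAbelianGroup.of c}

/-- The pre-Bloch group `𝒫(F)`. -/
abbrev PreBloch : Type _ := FreeAbelianGroup (Param F) ⧸ fiveTerm F

variable {F}

/-- The class `[z]` in `𝒫(F)`. -/
def PreBloch.of (z : Param F) : PreBloch F := QuotientAddGroup.mk (FreeAbelianGroup.of z)

theorem wedge_five_term (x y a b c : Param F) (ha : a.1 = y.1 / x.1)
    (hb : b.1 = (1 - x.1⁻¹) / (1 - y.1⁻¹)) (hc : c.1 = (1 - x.1) / (1 - y.1)) :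
    wedge x.unit x.oneSub - wedge y.unit y.oneSub + wedge a.unit a.oneSub
      - wedge b.unit b.oneSub + wedge c.unit c.oneSub = 0 := by
  have hx0 : x.1 ≠ 0 := x.2.1
  have hy0 : y.1 ≠ 0 := y.2.1
  have hx1 : 1 - x.1 ≠ 0 := sub_ne_zero.2 x.2.2.symm
  have hy1 : 1 - y.1 ≠ 0 := sub_ne_zero.2 y.2.2.symm
  have hyi : 1 - y.1⁻¹ ≠ 0 := by
    intro h
    apply y.2.2
    have h2 : y.1⁻¹ = 1 := (sub_eq_zero.1 h).symm
    exact inv_eq_one.1 h2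
  have hxy : x.1 - y.1 ≠ 0 := by
    intro h
    apply a.2.2
    rw [ha, ← sub_eq_zero.1 h, div_self hx0]
  have hy2 : y.1 - 1 ≠ 0 := sub_ne_zero.2 y.2.2
  set d : Fˣ := Units.mk0 (x.1 - y.1) hxy with hd
  have e1 : a.unit = y.unit / x.unit := by
    ext; simp [Param.unit, ha]
  have e2 : a.oneSub = d / x.unit := by
    ext; simp only [Param.oneSub, Param.unit, Units.val_mk0, Units.val_div_eq_div_val, hd, ha]
    field_simp
  have e3 : b.unit = (y.unit * x.oneSub) / (x.unit * y.oneSub) := by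
    ext
    simp only [Param.oneSub, Param.unit, Units.val_mk0, Units.val_div_eq_div_val, Units.val_mul, hb]
    rw [div_eq_div_iff hyi (mul_ne_zero hx0 hy1)]
    field_simp
    ring
  have e4 : b.oneSub = d / (x.unit * y.oneSub) := by
    ext
    simp only [Param.oneSub, Param.unit, Units.val_mk0, Units.val_div_eq_div_val, Units.val_mul,
      hd, hb]
    rw [eq_div_iff (mul_ne_zero hx0 hy1), sub_mul, div_mul_eq_mul_div, sub_eq_iff_eq_add,
      ← sub_eq_iff_eq_add', eq_div_iff hyi]
    field_simp
    ring
  have e5 : c.unit = x.oneSub / y.oneSub := by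
    ext; simp [Param.unit, Param.oneSub, hc]
  have e6 : c.oneSub = d / y.oneSub := by
    ext; simp only [Param.oneSub, Units.val_mk0, Units.val_div_eq_div_val, hd, hc]
    field_simp
    ring
  rw [e1, e2, e3, e4, e5, e6]
  simp only [wedge_div_left, wedge_div_right, wedge_mul_left, wedge_mul_right]
  have s1 := wedge_add_swap x.unit x.oneSub
  have s2 := wedge_add_swap x.unit y.oneSub
  rw [add_eq_zero_iff_eq_neg] at s1 s2
  rw [s1, s2]
  abel

variable (F)

/-- The homomorphism `δ : 𝒫(F) → ∧² Fˣ`, `δ [z] = z ∧ (1 - z)`. -/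
def delta : PreBloch F →+ ExtSq F :=
  QuotientAddGroup.lift (fiveTerm F)
    (FreeAbelianGroup.lift fun z : Param F => wedge z.unit z.oneSub) (by
      rw [fiveTerm, AddSubgroup.closure_le]
      rintro r ⟨x, y, a, b, c, ha, hb, hc, rfl⟩
      simp only [SetLike.mem_coe, AddMonoidHom.mem_ker, map_add, map_sub,
        FreeAbelianGroup.lift_apply_of]
      exact wedge_five_term x y a b c ha hb hc)

/-- The Bloch group `ℬ(F)`, the kernel of `δ`. -/
def Bloch : AddSubgroup (PreBloch F) := (delta F).ker

end Bloch

/-! ### Hyperbolic space and its isometries -/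

/-- `SL(2, ℂ)`. -/
abbrev SL2 : Type := Matrix.SpecialLinearGroup (Fin 2) ℂ

/-- `PSL(2, ℂ)`, with the quotient topology of `SL(2, ℂ)`. -/
abbrev PSL2 : Type := Matrix.ProjectiveSpecialLinearGroup (Fin 2) ℂ

/-- The complex projective line. -/
abbrev CP1 : Type := ℙ ℂ (Fin 2 → ℂ)

/-- Hyperbolic 3-space: positive definite Hermitian `2 × 2` matrices of determinant one. -/
def H3 : Type := {H : Matrix (Fin 2) (Fin 2) ℂ // H.PosDef ∧ H.det = 1}

instance : TopologicalSpace H3 :=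
  inferInstanceAs (TopologicalSpace {H : Matrix (Fin 2) (Fin 2) ℂ // H.PosDef ∧ H.det = 1})

instance : MeasurableSpace H3 := borel H3

instance : BorelSpace H3 := ⟨rfl⟩

theorem SL2.act_mem (g : SL2) (H : H3) :
    (g.1 * H.1 * g.1.conjTranspose).PosDef ∧ (g.1 * H.1 * g.1.conjTranspose).det = 1 := by
  refine ⟨H.2.1.mul_mul_conjTranspose_same ?_, ?_⟩
  · apply Matrix.vecMul_injective_of_isUnit
    rw [Matrix.isUnit_iff_isUnit_det, g.2]
    exact isUnit_one
  · rw [Matrix.det_mul, Matrix.det_mul, Matrix.det_conjTranspose, g.2, H.2.2]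
    simp

/-- `SL(2, ℂ)` acts on hyperbolic space by `g • H = g H g*`. -/
instance : MulAction SL2 H3 where
  smul g H := ⟨g.1 * H.1 * g.1.conjTranspose, SL2.act_mem g H⟩
  one_smul H := Subtype.ext (by
    change (1 : SL2).1 * H.1 * (1 : SL2).1.conjTranspose = H.1
    simp)
  mul_smul g h H := Subtype.ext (by
    change (g * h).1 * H.1 * (g * h).1.conjTranspose =
      g.1 * (h.1 * H.1 * h.1.conjTranspose) * g.1.conjTranspose
    simp [Matrix.conjTranspose_mul, Matrix.mul_assoc])

theorem center_smul_H3 (g : SL2) (hg : g ∈ Subgroup.center SL2) (H : H3) : g • H = H := by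
  obtain ⟨r, hr, h⟩ := Matrix.SpecialLinearGroup.mem_center_iff.1 hg
  apply Subtype.ext
  change g.1 * H.1 * g.1.conjTranspose = H.1
  have hr2 : r = 1 ∨ r = -1 := by
    rw [Fintype.card_fin] at hr
    exact sq_eq_one_iff.1 hr
  rw [← h]
  rcases hr2 with rfl | rfl
  · simp
  · simp only [map_neg, map_one, Matrix.conjTranspose_neg, Matrix.conjTranspose_one, neg_mul,
      one_mul, mul_neg, mul_one, neg_neg]

theorem center_smul_CP1 (g : SL2) (hg : g ∈ Subgroup.center SL2) (p : CP1) : g • p = p := by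
  obtain ⟨r, hr, h⟩ := Matrix.SpecialLinearGroup.mem_center_iff.1 hg
  induction p using Projectivization.ind with
  | h v hv =>
    rw [Projectivization.smul_mk, Projectivization.mk_eq_mk_iff']
    refine ⟨r, ?_⟩
    change r • v = g.1.mulVec v
    rw [← h]
    simp

/-- The action of `PSL(2, ℂ)` on hyperbolic space. -/
instance : MulAction PSL2 H3 :=
  MulAction.compHom H3 (QuotientGroup.lift (Subgroup.center SL2) (MulAction.toPermHom SL2 H3)
    fun g hg => Equiv.ext fun H => center_smul_H3 g hg H)

/-- The action of `PSL(2, ℂ)` on the projective line. -/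
instance : MulAction PSL2 CP1 :=
  MulAction.compHom CP1 (QuotientGroup.lift (Subgroup.center SL2) (MulAction.toPermHom SL2 CP1)
    fun g hg => Equiv.ext fun p => center_smul_CP1 g hg p)

theorem mk_smul_H3 (g : SL2) (H : H3) : (QuotientGroup.mk g : PSL2) • H = g • H := rfl

theorem mk_smul_CP1 (g : SL2) (p : CP1) : (QuotientGroup.mk g : PSL2) • p = g • p := rfl

/-- The horoball of size `s` based at the point at infinity `p`, that is, the set of `H` with
`v* H⁻¹ v < s`, where `v` is a representative of `p`. -/
def horoball (p : CP1) (s : ℝ) : Set H3 :=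
  {H | (star p.rep ⬝ᵥ H.1⁻¹.mulVec p.rep).re < s}

theorem horoball_mono (p : CP1) {s t : ℝ} (h : s ≤ t) : horoball p s ⊆ horoball p t :=
  fun _ hH => lt_of_lt_of_le (show _ < s from hH) h

/-- The upper half-space coordinates: `(z, t)` corresponds to
`t⁻¹ • !![|z|² + t², z; conj z, 1]`. -/
def upperMatrix (z : ℂ) (t : ℝ) : Matrix (Fin 2) (Fin 2) ℂ :=
  (t : ℂ)⁻¹ • !![(Complex.normSq z + t ^ 2 : ℂ), z; (starRingEnd ℂ) z, 1]

theorem upperMatrix_mem (z : ℂ) {t : ℝ} (ht : 0 < t) :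
    (upperMatrix z t).PosDef ∧ (upperMatrix z t).det = 1 := by
  have htc : (t : ℂ) ≠ 0 := by exact_mod_cast ht.ne'
  have hs : ((Real.sqrt t : ℝ) : ℂ) * (Real.sqrt t : ℝ) = t := by
    rw [← Complex.ofReal_mul, Real.mul_self_sqrt ht.le]
  have hs0 : ((Real.sqrt t : ℝ) : ℂ) ≠ 0 := by
    exact_mod_cast (Real.sqrt_pos.2 ht).ne'
  have hsi : ((Real.sqrt t : ℝ) : ℂ)⁻¹ * ((Real.sqrt t : ℝ) : ℂ)⁻¹ = (t : ℂ)⁻¹ := by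
    rw [← mul_inv, hs]
  refine ⟨?_, ?_⟩
  · set B : Matrix (Fin 2) (Fin 2) ℂ := ((Real.sqrt t : ℝ) : ℂ)⁻¹ • !![(t : ℂ), z; 0, 1] with hB
    have hBB : upperMatrix z t = B * 1 * B.conjTranspose := by
      rw [hB, mul_one, Matrix.conjTranspose_smul, Matrix.smul_mul, Matrix.mul_smul, smul_smul]
      have : star ((Real.sqrt t : ℝ) : ℂ)⁻¹ = ((Real.sqrt t : ℝ) : ℂ)⁻¹ := by
        rw [star_inv₀]; congr 1; exact Complex.conj_ofReal _
      rw [this, hsi, upperMatrix]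
      congr 1
      ext i j
      fin_cases i <;> fin_cases j <;>
        simp [Matrix.mul_apply, Fin.sum_univ_two, ← Complex.mul_conj]
      ring
    rw [hBB]
    apply Matrix.PosDef.one.mul_mul_conjTranspose_same
    apply Matrix.vecMul_injective_of_isUnit
    rw [Matrix.isUnit_iff_isUnit_det, isUnit_iff_ne_zero, hB, Matrix.det_smul,
      Matrix.det_fin_two_of]
    simp [htc, hs0]
  · rw [upperMatrix, Matrix.det_smul, Matrix.det_fin_two_of, ← Complex.mul_conj]
    simp only [Fintype.card_fin]
    field_simp
    ring

/-- The point of hyperbolic space with upper half-space coordinates `(z, t)`. -/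
def ofUpper (q : ℂ × Set.Ioi (0 : ℝ)) : H3 := ⟨upperMatrix q.1 q.2, upperMatrix_mem q.1 q.2.2⟩

/-- The hyperbolic volume, `t⁻³ dx dy dt` in upper half-space coordinates. -/
def hypVolume : MeasureTheory.Measure H3 :=
  (((MeasureTheory.volume : MeasureTheory.Measure ℂ).prod
    ((MeasureTheory.volume : MeasureTheory.Measure ℝ).comap
      (Subtype.val : Set.Ioi (0 : ℝ) → ℝ))).withDensity
    fun q => ENNReal.ofReal (((q.2 : ℝ) ^ 3)⁻¹)).map ofUpper

/-! ### Hyperbolic manifolds of finite volume and their cusps -/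

/-- `Γ` is discrete, torsion-free and of finite covolume in `PSL(2, ℂ)`: the quotient `ℍ³/Γ` is an
oriented complete hyperbolic 3-manifold of finite volume. -/
structure IsFiniteVolume (Γ : Subgroup PSL2) : Prop where
  discrete : DiscreteTopology Γ
  torsionFree : ∀ γ ∈ Γ, IsOfFinOrder γ → γ = 1
  finiteVolume : ∃ D : Set H3,
    MeasureTheory.IsFundamentalDomain Γ D hypVolume ∧ hypVolume D ≠ ∞

/-- `p` is a cusp of `Γ`: it is fixed by a parabolic element of `Γ`. -/
def IsCusp (Γ : Subgroup PSL2) (p : CP1) : Prop :=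
  ∃ g : SL2, g.1.IsParabolic ∧ (QuotientGroup.mk g : PSL2) ∈ Γ ∧ g • p = p

theorem IsCusp.smul {Γ : Subgroup PSL2} {p : CP1} (hp : IsCusp Γ p) (γ : Γ) :
    IsCusp Γ ((γ : PSL2) • p) := by
  obtain ⟨g, hg, hgΓ, hgp⟩ := hp
  obtain ⟨γ, hγ⟩ := γ
  obtain ⟨h, rfl⟩ := QuotientGroup.mk_surjective γ
  refine ⟨h * g * h⁻¹, ?_, ?_, ?_⟩
  · have := (Matrix.isParabolic_conj_iff (m := g.1)
      (Matrix.SpecialLinearGroup.toGL h : GL (Fin 2) ℂ)).2 hg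
    rw [← Matrix.coe_units_inv, ← map_inv] at this
    exact this
  · exact Γ.mul_mem (Γ.mul_mem hγ hgΓ) (Γ.inv_mem hγ)
  · change (h * g * h⁻¹) • (h • p) = h • p
    rw [mul_smul, inv_smul_smul, mul_smul, hgp]

/-- The cusps of `Γ`. -/
abbrev Cusp (Γ : Subgroup PSL2) : Type := {p : CP1 // IsCusp Γ p}

/-- Hyperbolic space together with the cusps of `Γ`. -/
inductive Completed (Γ : Subgroup PSL2) : Type
  | inner (H : H3) : Completed Γ
  | cusp (c : Cusp Γ) : Completed Γ

/-- The horoball topology: hyperbolic space is open in it, and the horoballs based at a cusp form,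
together with the cusp, a basis of neighbourhoods of the cusp. -/
instance (Γ : Subgroup PSL2) : TopologicalSpace (Completed Γ) where
  IsOpen U := IsOpen {H : H3 | Completed.inner H ∈ U} ∧
    ∀ c : Cusp Γ, Completed.cusp c ∈ U →
      ∃ s : ℝ, 0 < s ∧ ∀ H ∈ horoball c.1 s, Completed.inner H ∈ U
  isOpen_univ := ⟨by simp, fun _ _ => ⟨1, one_pos, fun _ _ => trivial⟩⟩
  isOpen_inter := by
    rintro U V ⟨hU, hU'⟩ ⟨hV, hV'⟩
    refine ⟨hU.inter hV, fun c hc => ?_⟩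
    obtain ⟨s, hs, h⟩ := hU' c hc.1
    obtain ⟨s', hs', h'⟩ := hV' c hc.2
    exact ⟨min s s', lt_min hs hs', fun H hH =>
      ⟨h H (horoball_mono _ (min_le_left _ _) hH), h' H (horoball_mono _ (min_le_right _ _) hH)⟩⟩
  isOpen_sUnion := by
    intro S hS
    refine ⟨?_, ?_⟩
    · have : {H : H3 | Completed.inner H ∈ ⋃₀ S}
          = ⋃ U ∈ S, {H : H3 | (Completed.inner H : Completed Γ) ∈ U} := by
        ext H; simp
      rw [this]
      exact isOpen_biUnion fun U hU => (hS U hU).1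
    · rintro c ⟨U, hU, hc⟩
      obtain ⟨s, hs, h⟩ := (hS U hU).2 c hc
      exact ⟨s, hs, fun H hH => ⟨U, hU, h H hH⟩⟩

/-- The action of `Γ` on hyperbolic space together with the cusps. -/
instance (Γ : Subgroup PSL2) : MulAction Γ (Completed Γ) where
  smul γ x := match x with
    | .inner H => .inner (γ • H)
    | .cusp c => .cusp ⟨(γ : PSL2) • c.1, c.2.smul γ⟩
  one_smul x := by
    cases x with
    | inner H => exact congrArg Completed.inner (one_smul Γ H)
    | cusp c => exact congrArg Completed.cusp (Subtype.ext (one_smul PSL2 c.1))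
  mul_smul γ γ' x := by
    cases x with
    | inner H => exact congrArg Completed.inner (mul_smul γ γ' H)
    | cusp c => exact congrArg Completed.cusp (Subtype.ext (mul_smul (γ : PSL2) (γ' : PSL2) c.1))

/-- For `M = ℍ³/Γ` of finite volume, the space `M̂` obtained from the compact manifold with interior
`M` by collapsing each boundary component to a point: `M` with one point added for each cusp. -/
abbrev CuspedQuotient (Γ : Subgroup PSL2) : Type :=
  MulAction.orbitRel.Quotient Γ (Completed Γ)

/-- The projection to `M̂`. -/
def toQuotient (Γ : Subgroup PSL2) (x : Completed Γ) : CuspedQuotient Γ := Quotient.mk'' x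

/-! ### Ideal triangulations -/

/-- The standard 3-simplex. -/
abbrev Simplex : Type := stdSimplex ℝ (Fin 4)

/-- The point of the simplex obtained by moving the `k`-th barycentric coordinate to the place
`σ k`, for all `k`. -/
def permSimplex (σ : Equiv.Perm (Fin 4)) (x : Simplex) : Simplex :=
  ⟨fun k => x.1 (σ.symm k), fun k => x.2.1 _, by
    rw [Equiv.sum_comp σ.symm (fun k => x.1 k)]; exact x.2.2⟩

/-- A pairing of the faces of a family of oriented tetrahedra with ordered vertices. The face `f` of
a tetrahedron is the one opposite to the vertex `f`. The face `f` of the tetrahedron `i` is glued to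
the face `perm i f f` of the tetrahedron `next i f`, the vertex `k ≠ f` going to `perm i f k`. The
gluing maps reverse the orientations of the faces, that is, the permutations are odd; faces of the
same tetrahedron may be glued, but no face is glued to itself. -/
structure FacePairing (ι : Type*) where
  next : ι → Fin 4 → ι
  perm : ι → Fin 4 → Equiv.Perm (Fin 4)
  sign_perm : ∀ i f, Equiv.Perm.sign (perm i f) = -1
  next_next : ∀ i f, next (next i f) (perm i f f) = i
  perm_perm : ∀ i f, perm (next i f) (perm i f f) = (perm i f)⁻¹
  ne_self : ∀ i f, (next i f, perm i f f) ≠ (i, f)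

namespace FacePairing

variable {ι : Type*} (P : FacePairing ι)

/-- The identification of the points of the face `f` of `i` with the points of the face to which it
is glued. -/
inductive Glued : (Σ _ : ι, Simplex) → (Σ _ : ι, Simplex) → Prop
  | face (i : ι) (f : Fin 4) (x : Simplex) (hx : x.1 f = 0) :
      Glued ⟨i, x⟩ ⟨P.next i f, permSimplex (P.perm i f) x⟩

/-- The topological space obtained by gluing the tetrahedra along their faces. -/
abbrev Realization : Type _ := Quot P.Glued

end FacePairing

/-- An ideal triangulation of `M = ℍ³/Γ` with tetrahedra indexed by `ι`: a (singular) triangulation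
of `M̂` whose vertices are the points of `M̂` that are not in `M`. -/
structure IdealTriangulation (Γ : Subgroup PSL2) (ι : Type*) extends FacePairing ι where
  homeo : toFacePairing.Realization ≃ₜ CuspedQuotient Γ
  cusp_iff_vertex : ∀ (i : ι) (x : Simplex),
    (∃ c : Cusp Γ, homeo (Quot.mk _ ⟨i, x⟩) = toQuotient Γ (.cusp c)) ↔
      ∃ k : Fin 4, x = stdSimplex.vertex k

/-- A development of an ideal triangulation by ideal tetrahedra. Each tetrahedron is lifted to
hyperbolic space with the cusps, the lifts of two faces that are glued differ by an element
of `Γ` (the side pairing), and the lift of each tetrahedron has four distinct vertices in the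
projective line. -/
structure Development {Γ : Subgroup PSL2} {ι : Type*} (T : IdealTriangulation Γ ι) where
  lift : ι → Simplex → Completed Γ
  continuous_lift : ∀ i, Continuous (lift i)
  toQuotient_lift : ∀ i x, toQuotient Γ (lift i x) = T.homeo (Quot.mk _ ⟨i, x⟩)
  sidePairing : ι → Fin 4 → Γ
  sidePairing_smul : ∀ i f x, x.1 f = 0 →
    sidePairing i f • lift i x = lift (T.next i f) (permSimplex (T.perm i f) x)
  vertex : ι → Fin 4 → Cusp Γ
  lift_vertex : ∀ i k, lift i (stdSimplex.vertex k) = .cusp (vertex i k)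
  vertex_injective : ∀ i, Function.Injective (vertex i)

/-! ### Cross-ratios and the Bloch sum -/

/-- The determinant `[v, w]` of two vectors of `ℂ²`. -/
def bracket (v w : Fin 2 → ℂ) : ℂ := v 0 * w 1 - w 0 * v 1

theorem bracket_rep_ne_zero {p q : CP1} (h : p ≠ q) : bracket p.rep q.rep ≠ 0 := by
  intro hb
  apply h
  rw [← p.mk_rep, ← q.mk_rep, Projectivization.mk_eq_mk_iff']
  have hq := q.rep_nonzero
  by_cases h0 : q.rep 0 = 0
  · have h1 : q.rep 1 ≠ 0 := fun h1 => hq (by ext k; fin_cases k <;> simp [h0, h1])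
    refine ⟨p.rep 1 / q.rep 1, ?_⟩
    ext k
    fin_cases k
    · simp only [bracket, h0, zero_mul, sub_zero, mul_eq_zero, h1, or_false] at hb
      simp [h0, hb]
    · simp [h1]
  · refine ⟨p.rep 0 / q.rep 0, ?_⟩
    ext k
    fin_cases k
    · simp [h0]
    · simp only [bracket] at hb
      simp only [Pi.smul_apply, smul_eq_mul]
      rw [div_mul_eq_mul_div, div_eq_iff h0]
      simp only [Fin.mk_one]
      linear_combination hb

/-- The cross-ratio `[p₀, p₁, p₂, p₃] = [v₂, v₀][v₃, v₁] / ([v₃, v₀][v₂, v₁])`, where `vᵢ` is any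
representative of `pᵢ`. It is `z` for the points `∞, 0, 1, z`. -/
def crossRatio (p : Fin 4 → CP1) : ℂ :=
  (bracket (p 2).rep (p 0).rep * bracket (p 3).rep (p 1).rep) /
    (bracket (p 3).rep (p 0).rep * bracket (p 2).rep (p 1).rep)

theorem crossRatio_mem {p : Fin 4 → CP1} (hp : Function.Injective p) :
    crossRatio p ≠ 0 ∧ crossRatio p ≠ 1 := by
  have h : ∀ i j : Fin 4, i ≠ j → bracket (p i).rep (p j).rep ≠ 0 :=
    fun i j hij => bracket_rep_ne_zero (hp.ne hij)
  have h20 := h 2 0 (by decide)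
  have h31 := h 3 1 (by decide)
  have h30 := h 3 0 (by decide)
  have h21 := h 2 1 (by decide)
  have h01 := h 0 1 (by decide)
  have h23 := h 2 3 (by decide)
  refine ⟨div_ne_zero (mul_ne_zero h20 h31) (mul_ne_zero h30 h21), fun h1 => ?_⟩
  rw [crossRatio, div_eq_one_iff_eq (mul_ne_zero h30 h21), ← sub_eq_zero] at h1
  apply mul_ne_zero h01 h23
  simp only [bracket] at h1 ⊢
  linear_combination h1

namespace Development

variable {Γ : Subgroup PSL2} {ι : Type*} {T : IdealTriangulation Γ ι} (D : Development T)

/-- The parameter `z_i` of the tetrahedron `i`: the cross-ratio of its developed vertices. -/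
def shape (i : ι) : Param ℂ :=
  ⟨crossRatio fun k => (D.vertex i k).1,
    crossRatio_mem (Subtype.val_injective.comp (D.vertex_injective i))⟩

/-- The Bloch sum `∑ z_i ∧ (1 - z_i)` in `∧² ℂˣ`. -/
def blochSum [Fintype ι] : ExtSq ℂ := ∑ i, wedge (D.shape i).unit (D.shape i).oneSub

/-- The invariant `β(T) = ∑ [z_i]` in `𝒫(ℂ)`. -/
def beta [Fintype ι] : PreBloch ℂ := ∑ i, PreBloch.of (D.shape i)

end Development

end BlochHyp

end

noncomputable section

namespace BlochHyp

open Filter Topology Matrix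

/-! Each cusp of `Γ` gets a vector of `ℂ²` representing it, chosen equivariantly under `Γ` up to
sign (`exists_equivariant_rep`). The obstruction is the eigenvalue of a stabilizer element on the
cusp line, and it must be `±1` (`IsCusp.mulVec_rep`). Modulus less than `1`, for the element or its
inverse, would let conjugation shrink a parabolic element to the identity. A unimodular eigenvalue
other than `±1` gives powers converging to the identity, hence torsion. Both contradict the
hypotheses on `Γ`.

With such vectors `v_k` at the vertices of a tetrahedron, the Plücker relation writes `z` and `1 -
z`, up to sign, as quotients of brackets `[v_j, v_k]`. Then `z ∧ (1 - z)` expands into terms `[v_a,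
v_b] ∧ [v_b, v_c]`, one for each corner of each face (`wedge_oneSub_eq_sum`). Signs are invisible in
`∧² ℂˣ` because `ℂˣ` is divisible. A corner term is therefore unchanged by a side pairing and
negated by reversing the face. Face gluings reverse orientation, so the corner terms of paired faces
cancel (`blochSum_eq_zero`). -/

/-! ### Discreteness and the stabilizers of cusps. -/

/-- In a discrete subgroup of `PSL(2, ℂ)`, a sequence represented by matrices converging to the
identity is trivial at some index. -/
theorem exists_mk_eq_one_of_tendsto {Γ : Subgroup PSL2} [DiscreteTopology Γ] {x : ℕ → SL2}
    (hx : ∀ n, (QuotientGroup.mk (x n) : PSL2) ∈ Γ)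
    (h1 : Tendsto (fun n => (x n).1) atTop (𝓝 1)) :
    ∃ n, (QuotientGroup.mk (x n) : PSL2) = 1 := by
  have hs : Tendsto x atTop (𝓝 1) := by
    exact tendsto_subtype_rng.2 h1
  have hq : Tendsto (fun n => (⟨QuotientGroup.mk (x n), hx n⟩ : Γ)) atTop (𝓝 1) := by
    rw [tendsto_subtype_rng]
    exact (QuotientGroup.continuous_mk.tendsto (1 : SL2)).comp hs
  rw [nhds_discrete, tendsto_pure] at hq
  obtain ⟨n, hn⟩ := hq.exists
  exact ⟨n, congrArg Subtype.val hn⟩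

theorem exists_scalar_of_mk_eq_one {g : SL2} (h : (QuotientGroup.mk g : PSL2) = 1) :
    ∃ r : ℂ, r ^ 2 = 1 ∧ Matrix.scalar (Fin 2) r = g.1 := by
  obtain ⟨r, hr, h⟩ := Matrix.SpecialLinearGroup.mem_center_iff.1
    ((QuotientGroup.eq_one_iff g).1 h)
  exact ⟨r, by simpa using hr, h⟩

/-- A unimodular complex number has powers with positive exponents converging to `1`. -/
theorem exists_pow_tendsto_one {l : ℂ} (hl : ‖l‖ = 1) :
    ∃ m : ℕ → ℕ, (∀ n, 0 < m n) ∧ Tendsto (fun n => l ^ m n) atTop (𝓝 1) := by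
  have hl0 : l ≠ 0 := by
    rintro rfl
    simp at hl
  -- The powers of `l` have a subsequence converging on the circle; quotients of its consecutive
  -- terms tend to `1`.
  obtain ⟨a, ha, φ, hφ, h⟩ := (isCompact_sphere (0 : ℂ) 1).tendsto_subseq
    (x := fun n : ℕ => l ^ n) (fun n => by simp [hl])
  have ha0 : a ≠ 0 := by
    rintro rfl
    simp at ha
  refine ⟨fun n => φ (n + 1) - φ n, fun n => Nat.sub_pos_of_lt (hφ n.lt_succ_self), ?_⟩
  have := (h.comp (tendsto_add_atTop_nat 1)).div h ha0
  rw [div_self ha0] at this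
  refine this.congr fun n => ?_
  simp only [Function.comp_apply, Pi.div_apply]
  rw [div_eq_iff (pow_ne_zero _ hl0), ← pow_add,
    Nat.sub_add_cancel (hφ n.lt_succ_self).le]

/-- Powers of a matrix of determinant one with distinct eigenvalues `l`, `l⁻¹`. -/
theorem pow_eq_of_eigenvalue {A : Matrix (Fin 2) (Fin 2) ℂ} {l : ℂ} (hl : l ≠ 0)
    (hl2 : l - l⁻¹ ≠ 0) (hA : A * A = (l + l⁻¹) • A - 1) (n : ℕ) :
    A ^ n = (l ^ n / (l - l⁻¹)) • (A - l⁻¹ • 1) - ((l⁻¹) ^ n / (l - l⁻¹)) • (A - l • 1) := by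
  induction n with
  | zero =>
    have : (A - l⁻¹ • 1) - (A - l • 1) = (l - l⁻¹) • (1 : Matrix (Fin 2) (Fin 2) ℂ) := by
      rw [sub_smul]; abel
    rw [pow_zero, pow_zero, pow_zero, ← smul_sub, this, smul_smul, one_div, inv_mul_cancel₀ hl2,
      one_smul]
  | succ n ih =>
    have e1 : (A - l⁻¹ • 1) * A = l • (A - l⁻¹ • 1) := by
      rw [sub_mul, hA, smul_sub, smul_smul, mul_inv_cancel₀ hl, smul_mul_assoc, one_mul, add_smul,
        one_smul]
      abel
    have e2 : (A - l • 1) * A = l⁻¹ • (A - l • 1) := by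
      rw [sub_mul, hA, smul_sub, smul_smul, inv_mul_cancel₀ hl, smul_mul_assoc, one_mul, add_smul,
        one_smul]
      abel
    rw [pow_succ, ih, sub_mul, smul_mul_assoc, smul_mul_assoc, e1, e2, smul_smul, smul_smul,
      pow_succ, pow_succ, div_mul_eq_mul_div, div_mul_eq_mul_div]

/-- Cayley–Hamilton: since the determinant is one, the other eigenvalue is `l⁻¹` and the trace is `l
+ l⁻¹`. -/
theorem SL2.mul_self_of_eigenvector (h : SL2) {v : Fin 2 → ℂ} (hv : v ≠ 0) {l : ℂ}
    (hl : h.1 *ᵥ v = l • v) : l ≠ 0 ∧ h.1 * h.1 = (l + l⁻¹) • h.1 - 1 := by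
  have hd : h.1 0 0 * h.1 1 1 - h.1 0 1 * h.1 1 0 = 1 := by
    rw [← Matrix.det_fin_two]; exact h.2
  have h0 : (h.1 - l • 1).det = 0 :=
    Matrix.exists_mulVec_eq_zero_iff.1 ⟨v, hv, by
      rw [Matrix.sub_mulVec, hl, Matrix.smul_mulVec, Matrix.one_mulVec, sub_self]⟩
  rw [Matrix.det_fin_two] at h0
  simp at h0
  have hl0 : l ≠ 0 := by
    rintro rfl
    simp at h0
    rw [h0] at hd
    exact zero_ne_one hd
  have ht : l + l⁻¹ = h.1 0 0 + h.1 1 1 := by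
    field_simp
    linear_combination h0 - hd
  refine ⟨hl0, ?_⟩
  rw [ht]
  ext i j
  fin_cases i <;> fin_cases j <;> simp [Matrix.mul_apply, Fin.sum_univ_two]
  · linear_combination -hd
  · ring
  · ring
  · linear_combination -hd

/-- An elliptic element does not belong to a discrete torsion-free group. -/
theorem eigenvalue_sq_eq_one_of_norm_eq_one {Γ : Subgroup PSL2} (hΓ : IsFiniteVolume Γ) {h : SL2}
    (hh : (QuotientGroup.mk h : PSL2) ∈ Γ) {v : Fin 2 → ℂ} (hv : v ≠ 0) {l : ℂ}
    (hl : h.1 *ᵥ v = l • v) (hn : ‖l‖ = 1) : l ^ 2 = 1 := by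
  have := hΓ.discrete
  by_contra hne
  obtain ⟨hl0, hA⟩ := h.mul_self_of_eigenvector hv hl
  have hl2 : l - l⁻¹ ≠ 0 := by
    intro hz
    apply hne
    field_simp at hz
    linear_combination hz
  obtain ⟨m, hm, hlim⟩ := exists_pow_tendsto_one hn
  obtain ⟨n, hn⟩ := exists_mk_eq_one_of_tendsto (Γ := Γ) (x := fun n => h ^ m n)
    (fun n => Γ.pow_mem hh _) (by
      have hlim' : Tendsto (fun n => (l⁻¹) ^ m n) atTop (𝓝 1) := by
        simpa using hlim.inv₀ one_ne_zero
      have key := ((hlim.div_const (l - l⁻¹)).smul_const (h.1 - l⁻¹ • 1)).sub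
        ((hlim'.div_const (l - l⁻¹)).smul_const (h.1 - l • 1))
      -- The limit of the closed formula for `h ^ m n` is the same formula at exponent `0`, which is
      -- the identity.
      have e0 := pow_eq_of_eigenvalue hl0 hl2 hA 0
      rw [pow_zero, pow_zero, pow_zero] at e0
      rw [← e0] at key
      refine key.congr fun n => ?_
      rw [Matrix.SpecialLinearGroup.coe_pow, pow_eq_of_eigenvalue hl0 hl2 hA])
  have h1 : (QuotientGroup.mk h : PSL2) = 1 :=
    hΓ.torsionFree _ hh (isOfFinOrder_iff_pow_eq_one.2 ⟨m n, hm n, hn⟩)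
  obtain ⟨r, hr, hrh⟩ := exists_scalar_of_mk_eq_one h1
  rw [← hrh] at hl
  have : r = l := by
    apply smul_left_injective ℂ hv
    simpa [Matrix.smul_mulVec] using hl
  exact hne (this ▸ hr)

/-- A nilpotent matrix killing an eigenvector of `h` is scaled by conjugation with `h`. -/
theorem SL2.mul_nilpotent (h : SL2) {v : Fin 2 → ℂ} (hv : v ≠ 0) {l : ℂ}
    (hl : h.1 *ᵥ v = l • v) {N : Matrix (Fin 2) (Fin 2) ℂ} (hN : N *ᵥ v = 0)
    (htr : N.trace = 0) : h.1 * N = l ^ 2 • (N * h.1) := by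
  -- Such an `N` is a multiple of the map `x ↦ [v, x] v`.
  obtain ⟨c, hc⟩ : ∃ c : ℂ, N = c • !![v 0 * v 1, -(v 0) ^ 2; (v 1) ^ 2, -(v 0 * v 1)] := by
    have h0 := congrFun hN 0
    have h1 := congrFun hN 1
    simp [Matrix.mulVec, dotProduct, Fin.sum_univ_two] at h0 h1
    rw [Matrix.trace_fin_two] at htr
    by_cases hx : v 0 = 0
    · have hy : v 1 ≠ 0 := fun hy => hv (by ext k; fin_cases k <;> simp [hx, hy])
      simp [hx, hy] at h0 h1
      refine ⟨N 1 0 / (v 1) ^ 2, ?_⟩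
      ext i j
      fin_cases i <;> fin_cases j <;> simp [hx, hy, h0, h1]
      simpa [h1] using htr
    · refine ⟨-(N 0 1) / (v 0) ^ 2, ?_⟩
      have e : N 0 0 = -(N 0 1 * v 1) / v 0 := by
        rw [eq_div_iff hx]; linear_combination h0
      have e' : N 1 1 = -N 0 0 := by linear_combination htr
      have e'' : N 1 0 = -(N 1 1 * v 1) / v 0 := by
        rw [eq_div_iff hx]; linear_combination h1
      rw [e', e] at e''
      rw [e] at e'
      ext i j
      fin_cases i <;> fin_cases j <;> simp [e, e', e''] <;> field_simp
  have hd : h.1 0 0 * h.1 1 1 - h.1 0 1 * h.1 1 0 = 1 := by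
    rw [← Matrix.det_fin_two]; exact h.2
  have h0 := congrFun hl 0
  have h1 := congrFun hl 1
  simp only [Matrix.mulVec, dotProduct, Fin.sum_univ_two, Pi.smul_apply, smul_eq_mul] at h0 h1
  -- `w0` and `w1` say `l [v, h x] = [v, x]` for the two basis vectors `x`. One factor `l` comes
  -- from here, the other from `h v = l v`.
  have w0 : l * (v 1 * h.1 0 0 - v 0 * h.1 1 0) = v 1 := by
    linear_combination v 1 * hd - h.1 0 0 * h1 + h.1 1 0 * h0
  have w1 : l * (v 1 * h.1 0 1 - v 0 * h.1 1 1) = - v 0 := by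
    linear_combination -v 0 * hd - h.1 0 1 * h1 + h.1 1 1 * h0
  rw [hc]
  ext i j
  fin_cases i <;> fin_cases j <;>
    simp only [Matrix.mul_apply, Fin.sum_univ_two, Matrix.smul_apply, smul_eq_mul, Fin.zero_eta,
      Fin.mk_one, Matrix.of_apply, Matrix.cons_val', Matrix.cons_val_zero, Matrix.cons_val_one,
      Matrix.cons_val_fin_one]
  · linear_combination c * v 1 * h0 - c * l * v 0 * w0
  · linear_combination -c * v 0 * h0 - c * l * v 0 * w1
  · linear_combination c * v 1 * h1 - c * l * v 1 * w0
  · linear_combination -c * v 0 * h1 - c * l * v 1 * w1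

/-- In a discrete group, an element fixing the fixed point of a parabolic element is not a
contraction at that point. -/
theorem one_le_norm_eigenvalue {Γ : Subgroup PSL2} [DiscreteTopology Γ] {g h : SL2}
    (hg : g.1.IsParabolic) (hgΓ : (QuotientGroup.mk g : PSL2) ∈ Γ)
    (hh : (QuotientGroup.mk h : PSL2) ∈ Γ) {v : Fin 2 → ℂ} (hv : v ≠ 0) {m l : ℂ}
    (hm : g.1 *ᵥ v = m • v) (hl : h.1 *ᵥ v = l • v) : 1 ≤ ‖l‖ := by
  by_contra! hlt
  obtain ⟨hm0, hgg⟩ := g.mul_self_of_eigenvector hv hm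
  have htr : g.1.trace ^ 2 = 4 := by
    have := hg.2
    rw [Matrix.discr_fin_two, g.2] at this
    linear_combination this
  have hd : g.1 0 0 * g.1 1 1 - g.1 0 1 * g.1 1 0 = 1 := by
    rw [← Matrix.det_fin_two]; exact g.2
  have h0 : (g.1 - m • 1).det = 0 :=
    Matrix.exists_mulVec_eq_zero_iff.1 ⟨v, hv, by
      rw [Matrix.sub_mulVec, hm, Matrix.smul_mulVec, Matrix.one_mulVec, sub_self]⟩
  rw [Matrix.det_fin_two] at h0
  simp at h0
  rw [Matrix.trace_fin_two] at htr
  have htr2 : g.1 0 0 + g.1 1 1 = 2 * m := by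
    -- The square is four times the characteristic polynomial at `m` plus the discriminant, and both
    -- vanish.
    have : (2 * m - (g.1 0 0 + g.1 1 1)) ^ 2 = 0 := by
      linear_combination 4 * h0 + htr - 4 * hd
    linear_combination -(pow_eq_zero_iff two_ne_zero).1 this
  have hm2 : m ^ 2 = 1 := by
    rw [htr2] at htr
    linear_combination htr / 4
  have hminv : m⁻¹ = m := by
    exact inv_eq_of_mul_eq_one_left (by rw [← sq, hm2])
  -- The eigenvalue of `g` may be `-1`; that of `g²` is `1`, so `g² - 1` kills `v` and has trace
  -- zero.
  set N := g.1 * g.1 - 1 with hN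
  have hNv : N *ᵥ v = 0 := by
    rw [hN, Matrix.sub_mulVec, ← Matrix.mulVec_mulVec, hm, Matrix.mulVec_smul, hm, smul_smul, ← sq,
      hm2, one_smul, Matrix.one_mulVec, sub_self]
  have hNt : N.trace = 0 := by
    rw [hN, hgg, hminv]
    simp only [Matrix.trace_sub, Matrix.trace_smul, Matrix.trace_fin_two g.1, htr2]
    simp
    linear_combination 4 * hm2
  have hhN := h.mul_nilpotent hv hl hNv hNt
  have hpow : ∀ k : ℕ, h.1 ^ k * N = (l ^ 2) ^ k • (N * h.1 ^ k) := by
    intro k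
    induction k with
    | zero => simp
    | succ k ih =>
      rw [pow_succ, mul_assoc, hhN, mul_smul_comm, ← mul_assoc, ih, smul_mul_assoc, smul_smul,
        mul_assoc, pow_succ (l ^ 2), mul_comm (l ^ 2)]
  -- The conjugates of `g²` by `h ^ k` are `1 + l ^ (2k) • N`, which tend to `1` because `‖l‖ < 1`.
  obtain ⟨k, hk⟩ := exists_mk_eq_one_of_tendsto (Γ := Γ)
    (x := fun k => h ^ k * (g * g) * (h ^ k)⁻¹)
    (fun k => Γ.mul_mem (Γ.mul_mem (Γ.pow_mem hh k) (Γ.mul_mem hgΓ hgΓ))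
      (Γ.inv_mem (Γ.pow_mem hh k))) (by
      have hl1 : ‖l ^ 2‖ < 1 := by
        rw [norm_pow]
        exact pow_lt_one₀ (norm_nonneg _) hlt two_ne_zero
      have key := ((tendsto_pow_atTop_nhds_zero_of_norm_lt_one hl1).smul_const N).const_add
        (1 : Matrix (Fin 2) (Fin 2) ℂ)
      rw [zero_smul, add_zero] at key
      refine key.congr fun k => ?_
      have e1 : (h ^ k * (h ^ k)⁻¹ : SL2).1 = 1 := by rw [mul_inv_cancel]; rfl
      rw [Matrix.SpecialLinearGroup.coe_mul, Matrix.SpecialLinearGroup.coe_pow] at e1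
      have e2 : g.1 * g.1 = 1 + N := by rw [hN]; abel
      rw [Matrix.SpecialLinearGroup.coe_mul, Matrix.SpecialLinearGroup.coe_mul,
        Matrix.SpecialLinearGroup.coe_mul, Matrix.SpecialLinearGroup.coe_pow, e2, mul_add, hpow,
        mul_one, add_mul, e1, smul_mul_assoc, mul_assoc N, e1, mul_one])
  have hk' : (QuotientGroup.mk (g * g) : PSL2) = 1 := by
    have : (QuotientGroup.mk h : PSL2) ^ k * QuotientGroup.mk (g * g)
      * ((QuotientGroup.mk h : PSL2) ^ k)⁻¹ = 1 := hk
    exact conj_eq_one_iff.1 this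
  obtain ⟨r, -, hr⟩ := exists_scalar_of_mk_eq_one hk'
  apply hg.1
  -- From `g² = r` and `g² = 2 m g - 1`, the matrix `g` would be this scalar, which a parabolic
  -- matrix is not.
  refine ⟨(r + 1) / (2 * m), ?_⟩
  rw [Matrix.SpecialLinearGroup.coe_mul, hgg, hminv, ← two_mul] at hr
  ext i j
  have := congrFun (congrFun hr i) j
  fin_cases i <;> fin_cases j <;> simp at this ⊢
  · field_simp; linear_combination this
  · exact (this.resolve_left hm0).symm
  · exact (this.resolve_left hm0).symm
  · field_simp; linear_combination this

/-- The elements of `Γ` that fix a cusp are represented by matrices with eigenvalues `±1`. -/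
theorem IsCusp.mulVec_rep {Γ : Subgroup PSL2} (hΓ : IsFiniteVolume Γ) {p : CP1} (hp : IsCusp Γ p)
    {h : SL2} (hh : (QuotientGroup.mk h : PSL2) ∈ Γ) (hhp : h • p = p) :
    h.1 *ᵥ p.rep = p.rep ∨ h.1 *ᵥ p.rep = -p.rep := by
  have hdisc := hΓ.discrete
  have eig : ∀ k : SL2, k • p = p → ∃ l : ℂ, k.1 *ᵥ p.rep = l • p.rep := by
    intro k hk
    rw [← p.mk_rep, Projectivization.smul_mk, Projectivization.mk_eq_mk_iff'] at hk
    obtain ⟨l, hl⟩ := hk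
    exact ⟨l, hl.symm⟩
  obtain ⟨g, hg, hgΓ, hgp⟩ := hp
  obtain ⟨m, hm⟩ := eig g hgp
  obtain ⟨l, hl⟩ := eig h hhp
  obtain ⟨l', hl'⟩ := eig h⁻¹ (inv_smul_eq_iff.2 hhp.symm)
  have hll : l * l' = 1 := by
    apply smul_left_injective ℂ p.rep_nonzero
    have e1 : (h⁻¹ * h : SL2).1 = 1 := by rw [inv_mul_cancel]; rfl
    rw [Matrix.SpecialLinearGroup.coe_mul] at e1
    change (l * l') • p.rep = (1 : ℂ) • p.rep
    rw [mul_smul, ← hl', ← Matrix.mulVec_smul, ← hl, Matrix.mulVec_mulVec, e1, Matrix.one_mulVec,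
      one_smul]
  -- Neither `h` nor `h⁻¹` contracts at the cusp, so the eigenvalue is unimodular.
  have n1 := one_le_norm_eigenvalue hg hgΓ hh p.rep_nonzero hm hl
  have n2 := one_le_norm_eigenvalue hg hgΓ (Γ.inv_mem hh) p.rep_nonzero hm hl'
  have n3 : ‖l‖ * ‖l'‖ = 1 := by rw [← norm_mul, hll, norm_one]
  have hn : ‖l‖ = 1 := by nlinarith
  have := eigenvalue_sq_eq_one_of_norm_eq_one hΓ hh p.rep_nonzero hl hn
  rcases sq_eq_one_iff.1 this with rfl | rfl
  · left; rw [hl, one_smul]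
  · right; rw [hl, neg_smul, one_smul]

/-! ### Signs in `∧² ℂˣ` -/

theorem exists_units_mul_self (x : ℂˣ) : ∃ y : ℂˣ, x = y * y := by
  obtain ⟨y, hy⟩ := IsAlgClosed.exists_eq_mul_self (x : ℂ)
  have hy0 : y ≠ 0 := by
    rintro rfl
    exact x.ne_zero (by rw [hy, mul_zero])
  exact ⟨Units.mk0 y hy0, Units.ext hy⟩

/-- With `x = y²`, one factor `2` moves across the wedge and turns `-1` into `1`. -/
theorem wedge_neg_one_left (x : ℂˣ) : wedge (-1) x = 0 := by
  obtain ⟨y, rfl⟩ := exists_units_mul_self x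
  rw [wedge_mul_right, ← wedge_mul_left, neg_mul_neg, mul_one]
  simp [wedge]

theorem wedge_neg_left (x y : ℂˣ) : wedge (-x) y = wedge x y := by
  rw [← neg_one_mul, wedge_mul_left, wedge_neg_one_left, zero_add]

theorem wedge_comm {F : Type*} [Field F] (x y : Fˣ) : wedge x y = -wedge y x :=
  eq_neg_of_add_eq_zero_left (wedge_add_swap x y)

theorem wedge_neg_right (x y : ℂˣ) : wedge x (-y) = wedge x y := by
  rw [wedge_comm, wedge_neg_left, ← wedge_comm]

/-- Antisymmetry alone gives `2 (y ∧ y) = 0`; with `x = y²`, `x ∧ x` is `4 (y ∧ y)`. -/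
theorem wedge_self (x : ℂˣ) : wedge x x = 0 := by
  obtain ⟨y, rfl⟩ := exists_units_mul_self x
  have := wedge_add_swap y y
  simp only [wedge_mul_left, wedge_mul_right, this, add_zero]

theorem wedge_congr_sign {x x' y y' : ℂˣ} (hx : x' = x ∨ x' = -x) (hy : y' = y ∨ y' = -y) :
    wedge x' y' = wedge x y := by
  rcases hx with rfl | rfl <;> rcases hy with rfl | rfl <;>
    simp only [wedge_neg_left, wedge_neg_right]

/-! ### Brackets -/

theorem bracket_comm (v w : Fin 2 → ℂ) : bracket w v = -bracket v w := by
  simp only [bracket]; ring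

theorem bracket_smul_smul (a b : ℂ) (v w : Fin 2 → ℂ) :
    bracket (a • v) (b • w) = a * b * bracket v w := by
  simp only [bracket, Pi.smul_apply, smul_eq_mul]; ring

theorem bracket_neg_left (v w : Fin 2 → ℂ) : bracket (-v) w = -bracket v w := by
  simp only [bracket, Pi.neg_apply]; ring

theorem bracket_neg_right (v w : Fin 2 → ℂ) : bracket v (-w) = -bracket v w := by
  simp only [bracket, Pi.neg_apply]; ring

theorem bracket_mulVec (g : SL2) (v w : Fin 2 → ℂ) :
    bracket (g.1 *ᵥ v) (g.1 *ᵥ w) = bracket v w := by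
  have hd : g.1 0 0 * g.1 1 1 - g.1 0 1 * g.1 1 0 = 1 := by
    rw [← Matrix.det_fin_two]; exact g.2
  simp only [bracket, Matrix.mulVec, dotProduct, Fin.sum_univ_two]
  linear_combination (v 0 * w 1 - w 0 * v 1) * hd

/-- The bracket of two vectors as a unit, with the value `1` when the vectors are proportional. -/
def bracketUnit (v w : Fin 2 → ℂ) : ℂˣ :=
  if h : bracket v w = 0 then 1 else Units.mk0 (bracket v w) h

theorem bracketUnit_val {v w : Fin 2 → ℂ} (h : bracket v w ≠ 0) :
    (bracketUnit v w : ℂ) = bracket v w := by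
  rw [bracketUnit, dif_neg h, Units.val_mk0]

/-- Both brackets vanish together, so the default value `1` is taken on both sides and no
nondegeneracy is needed. -/
theorem bracketUnit_congr_sign {v w v' w' : Fin 2 → ℂ}
    (h : bracket v' w' = bracket v w ∨ bracket v' w' = -bracket v w) :
    bracketUnit v' w' = bracketUnit v w ∨ bracketUnit v' w' = -bracketUnit v w := by
  by_cases h0 : bracket v w = 0
  · have h0' : bracket v' w' = 0 := by
      rcases h with h | h <;> simp [h, h0]
    left
    rw [bracketUnit, bracketUnit, dif_pos h0, dif_pos h0']
  · have h0' : bracket v' w' ≠ 0 := by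
      rcases h with h | h <;> simp [h, h0]
    rw [Units.ext_iff, Units.ext_iff, Units.val_neg, bracketUnit_val h0, bracketUnit_val h0']
    exact h

/-! ### Corner terms of the faces of a tetrahedron. -/

/-- The contribution `[v, w] ∧ [w, x]` of a corner of a triangle. -/
def cornerWedge (v w x : Fin 2 → ℂ) : ExtSq ℂ := wedge (bracketUnit v w) (bracketUnit w x)

/-- This is the cancellation mechanism: reversal exchanges the two factors, and the resulting signs
of the brackets do not matter. -/
theorem cornerWedge_reverse (v w x : Fin 2 → ℂ) : cornerWedge x w v = -cornerWedge v w x := by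
  rw [cornerWedge, cornerWedge, ← wedge_comm]
  exact wedge_congr_sign (bracketUnit_congr_sign (.inr (bracket_comm _ _)))
    (bracketUnit_congr_sign (.inr (bracket_comm _ _)))

theorem cornerWedge_mulVec (g : SL2) {v w x v' w' x' : Fin 2 → ℂ}
    (hv : v' = g.1 *ᵥ v ∨ v' = -(g.1 *ᵥ v)) (hw : w' = g.1 *ᵥ w ∨ w' = -(g.1 *ᵥ w))
    (hx : x' = g.1 *ᵥ x ∨ x' = -(g.1 *ᵥ x)) : cornerWedge v' w' x' = cornerWedge v w x := by
  have key : ∀ {a b a' b' : Fin 2 → ℂ}, (a' = g.1 *ᵥ a ∨ a' = -(g.1 *ᵥ a)) →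
      (b' = g.1 *ᵥ b ∨ b' = -(g.1 *ᵥ b)) →
      bracket a' b' = bracket a b ∨ bracket a' b' = -bracket a b := by
    intro a b a' b' ha hb
    have e := bracket_mulVec g a b
    rw [← e]
    rcases ha with rfl | rfl <;> rcases hb with rfl | rfl <;>
      simp only [bracket_neg_left, bracket_neg_right, neg_neg, true_or, or_true]
  exact wedge_congr_sign (bracketUnit_congr_sign (key hv hw)) (bracketUnit_congr_sign (key hw hx))

/-- An even `t` encodes the face opposite to `t 0` with a cyclic labelling `t 1, t 2, t 3`
compatible with the orientation: four faces, three corners each. -/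
theorem sum_alternatingGroup_four {A : Type*} [AddCommMonoid A] (f : Fin 4 → Fin 4 → Fin 4 → A) :
    ∑ t : alternatingGroup (Fin 4), f (t.1 1) (t.1 2) (t.1 3) =
      f 1 2 3 + f 2 3 1 + f 3 1 2 + f 0 3 2 + f 3 2 0 + f 2 0 3 + f 0 1 3 + f 1 3 0 + f 3 0 1 +
        f 0 2 1 + f 2 1 0 + f 1 0 2 := by
  have h : (Finset.univ : Finset (alternatingGroup (Fin 4))).val.map
      (fun t => (t.1 1, t.1 2, t.1 3)) =
      ([(1, 2, 3), (2, 3, 1), (3, 1, 2), (0, 3, 2), (3, 2, 0), (2, 0, 3), (0, 1, 3), (1, 3, 0),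
        (3, 0, 1), (0, 2, 1), (2, 1, 0), (1, 0, 2)] : List (Fin 4 × Fin 4 × Fin 4)) := by
    decide +kernel
  have := congrArg (fun s : Multiset (Fin 4 × Fin 4 × Fin 4) =>
    (s.map fun x => f x.1 x.2.1 x.2.2).sum) h
  simp only [Multiset.map_map] at this
  refine this.trans ?_
  simp [add_assoc]

/-- `z ∧ (1 - z)` is a sum over the corners of the faces of the tetrahedron. -/
theorem wedge_oneSub_eq_sum {u : Fin 4 → Fin 2 → ℂ} {z : Param ℂ}
    (hu : ∀ i j, i ≠ j → bracket (u i) (u j) ≠ 0)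
    (hz : z.1 = (bracket (u 2) (u 0) * bracket (u 3) (u 1)) /
      (bracket (u 3) (u 0) * bracket (u 2) (u 1))) :
    wedge z.unit z.oneSub =
      -∑ t : alternatingGroup (Fin 4), cornerWedge (u (t.1 1)) (u (t.1 2)) (u (t.1 3)) := by
  set e : Fin 4 → Fin 4 → ℂˣ := fun i j => bracketUnit (u i) (u j) with he
  have hev : ∀ i j, i ≠ j → (e i j : ℂ) = bracket (u i) (u j) :=
    fun i j h => bracketUnit_val (hu i j h)
  have h30 := hu 3 0 (by decide)
  have h21 := hu 2 1 (by decide)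
  have e1 : z.unit = e 2 0 * e 3 1 / (e 3 0 * e 2 1) := by
    ext
    simp only [Param.unit, Units.val_mk0, Units.val_div_eq_div_val, Units.val_mul, hz]
    rw [hev 2 0 (by decide), hev 3 1 (by decide), hev 3 0 (by decide), hev 2 1 (by decide)]
  -- This is the Plücker relation between the brackets of four vectors.
  have e2 : z.oneSub = -(e 0 1 * e 2 3 / (e 3 0 * e 2 1)) := by
    simp only [Units.ext_iff, Param.oneSub, Units.val_neg, Units.val_mk0,
      Units.val_div_eq_div_val, Units.val_mul, hz]
    rw [hev 0 1 (by decide), hev 2 3 (by decide), hev 3 0 (by decide), hev 2 1 (by decide)]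
    rw [eq_comm, neg_eq_iff_eq_neg, div_eq_iff (mul_ne_zero h30 h21), neg_mul, sub_mul,
      div_mul_cancel₀ _ (mul_ne_zero h30 h21)]
    simp only [bracket]; ring
  have hs : ∀ i j, e j i = e i j ∨ e j i = -e i j :=
    fun i j => bracketUnit_congr_sign (.inr (bracket_comm _ _))
  have e3 : wedge z.unit z.oneSub =
      wedge (e 2 0 * e 3 1 / (e 3 0 * e 2 1)) (e 0 1 * e 2 3 / (e 3 0 * e 2 1)) :=
    wedge_congr_sign (.inl e1) (.inr e2)
  have hc : ∀ i j k, cornerWedge (u i) (u j) (u k) = wedge (e i j) (e j k) := fun _ _ _ => rfl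
  have hl : ∀ i j x, wedge (e i j) x = wedge (e j i) x :=
    fun i j x => wedge_congr_sign (hs j i) (.inl rfl)
  have hr : ∀ i j x, wedge x (e i j) = wedge x (e j i) :=
    fun i j x => wedge_congr_sign (.inl rfl) (hs j i)
  rw [e3, sum_alternatingGroup_four fun i j k => cornerWedge (u i) (u j) (u k)]
  -- Of the sixteen terms, two are of the form `x ∧ x` and the two pairing the opposite edges `03`
  -- and `12` cancel. The other twelve pair edges sharing a vertex, that is, corners.
  simp only [hc, wedge_div_left, wedge_div_right, wedge_mul_left, wedge_mul_right, wedge_self]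
  simp only [hl 2 0, hr 2 0, hl 3 1, hr 3 1, hl 3 0, hr 3 0, hl 2 1, hr 2 1, hl 1 0, hr 1 0,
    hl 3 2, hr 3 2]
  rw [wedge_comm (e 1 2) (e 0 3), wedge_comm (e 0 2) (e 0 1), wedge_comm (e 0 2) (e 2 3),
    wedge_comm (e 1 3) (e 0 1), wedge_comm (e 1 3) (e 2 3), wedge_comm (e 0 3) (e 0 1),
    wedge_comm (e 0 3) (e 2 3), wedge_comm (e 1 2) (e 0 1), wedge_comm (e 1 2) (e 2 3)]
  abel

/-! ### Equivariant representatives of the cusps -/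

/-- There is a choice of vectors representing the points of the projective line that is equivariant
up to sign on the cusps. -/
theorem exists_equivariant_rep {Γ : Subgroup PSL2} (hΓ : IsFiniteVolume Γ) :
    ∃ u : CP1 → Fin 2 → ℂ, (∀ p, ∃ a : ℂ, a ≠ 0 ∧ u p = a • p.rep) ∧
      ∀ (p : CP1) (g : SL2), IsCusp Γ p → (QuotientGroup.mk g : PSL2) ∈ Γ →
        (u (g • p) = g.1 *ᵥ u p ∨ u (g • p) = -(g.1 *ᵥ u p)) := by
  -- A base point is chosen in each orbit, and its vector is transported to `p` by some `k p` over
  -- `Γ`.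
  set r : CP1 → CP1 := fun p => (Quotient.mk'' p : MulAction.orbitRel.Quotient Γ CP1).out with hr
  have hk : ∀ p, ∃ k : SL2, (QuotientGroup.mk k : PSL2) ∈ Γ ∧ k • r p = p := by
    intro p
    have : (MulAction.orbitRel Γ CP1) p (r p) :=
      (MulAction.orbitRel Γ CP1).symm (Quotient.mk_out (s := MulAction.orbitRel Γ CP1) p)
    obtain ⟨⟨γ, hγ⟩, h⟩ := this
    obtain ⟨k, rfl⟩ := QuotientGroup.mk_surjective γ
    exact ⟨k, hγ, h⟩
  choose k hkΓ hkp using hk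
  refine ⟨fun p => (k p).1 *ᵥ (r p).rep, fun p => ?_, fun p g hp hg => ?_⟩
  · have h := hkp p
    rw [← (r p).mk_rep, ← p.mk_rep, Projectivization.smul_mk, Projectivization.mk_eq_mk_iff] at h
    obtain ⟨a, ha⟩ := h
    rw [p.mk_rep] at ha
    exact ⟨a, a.ne_zero, ha.symm⟩
  · have hrr : r (g • p) = r p :=
      congrArg Quotient.out (Quotient.sound
        (s := MulAction.orbitRel Γ CP1) ⟨⟨QuotientGroup.mk g, hg⟩, rfl⟩)
    -- The two transports to `g • p` differ by an element fixing the base point, which acts on its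
    -- vector by `±1`.
    set h : SL2 := (g * k p)⁻¹ * k (g • p) with hh
    have hhΓ : (QuotientGroup.mk h : PSL2) ∈ Γ :=
      Γ.mul_mem (Γ.inv_mem (Γ.mul_mem hg (hkΓ p))) (hkΓ (g • p))
    have hfix : h • r p = r p := by
      rw [hh, mul_smul, inv_smul_eq_iff, mul_smul, hkp]
      conv_lhs => rw [← hrr]
      exact hkp (g • p)
    have hcusp : IsCusp Γ (r p) := by
      have := hp.smul ⟨QuotientGroup.mk (k p)⁻¹, Γ.inv_mem (hkΓ p)⟩
      have e : (k p)⁻¹ • p = r p := inv_smul_eq_iff.2 (hkp p).symm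
      rw [← e]
      exact this
    have hmul : (k (g • p)).1 = g.1 * (k p).1 * h.1 := by
      rw [← Matrix.SpecialLinearGroup.coe_mul, ← Matrix.SpecialLinearGroup.coe_mul, hh,
        mul_inv_cancel_left]
    simp only [hrr]
    rw [hmul, ← Matrix.mulVec_mulVec, Matrix.mulVec_mulVec _ g.1]
    rcases hcusp.mulVec_rep hΓ hhΓ hfix with e | e
    · left; rw [e]
    · right; rw [e, Matrix.mulVec_neg]

/-! ### The Bloch identity -/

namespace Development

variable {Γ : Subgroup PSL2} {ι : Type*} {T : IdealTriangulation Γ ι} (D : Development T)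

theorem sidePairing_smul_vertex (i : ι) {f k : Fin 4} (hk : k ≠ f) :
    (D.sidePairing i f : PSL2) • (D.vertex i k).1 = (D.vertex (T.next i f) (T.perm i f k)).1 := by
  have h := D.sidePairing_smul i f (stdSimplex.vertex k) (by simp [hk])
  have hp : permSimplex (T.perm i f) (stdSimplex.vertex k) =
      stdSimplex.vertex (T.perm i f k) := by
    apply Subtype.ext
    ext j
    simp [permSimplex, Pi.single_apply, Equiv.symm_apply_eq]
  rw [hp, D.lift_vertex, D.lift_vertex] at h
  exact congrArg Subtype.val (Completed.cusp.inj h)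

theorem exists_mulVec_vertex {u : CP1 → Fin 2 → ℂ}
    (hu : ∀ (p : CP1) (g : SL2), IsCusp Γ p → (QuotientGroup.mk g : PSL2) ∈ Γ →
      (u (g • p) = g.1 *ᵥ u p ∨ u (g • p) = -(g.1 *ᵥ u p))) (i : ι) (f : Fin 4) :
    ∃ g : SL2, ∀ k, k ≠ f →
      (u (D.vertex (T.next i f) (T.perm i f k)).1 = g.1 *ᵥ u (D.vertex i k).1 ∨
        u (D.vertex (T.next i f) (T.perm i f k)).1 = -(g.1 *ᵥ u (D.vertex i k).1)) := by
  obtain ⟨g, hg⟩ := QuotientGroup.mk_surjective (D.sidePairing i f : PSL2)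
  refine ⟨g, fun k hk => ?_⟩
  rw [← D.sidePairing_smul_vertex i hk, ← hg, mk_smul_CP1]
  exact hu _ g (D.vertex i k).2 (hg ▸ (D.sidePairing i f).2)

theorem blochSum_eq_zero [Fintype ι] (hΓ : IsFiniteVolume Γ) : D.blochSum = 0 := by
  obtain ⟨u, hur, hu⟩ := exists_equivariant_rep hΓ
  set w : ι → Fin 4 → Fin 2 → ℂ := fun i k => u (D.vertex i k).1 with hw
  have hshape : ∀ i, wedge (D.shape i).unit (D.shape i).oneSub =
      -∑ t : alternatingGroup (Fin 4),
        cornerWedge (w i (t.1 1)) (w i (t.1 2)) (w i (t.1 3)) := by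
    intro i
    choose a ha0 ha using fun k => hur (D.vertex i k).1
    have hb : ∀ j k, bracket (w i j) (w i k) =
        a j * a k * bracket (D.vertex i j).1.rep (D.vertex i k).1.rep := by
      intro j k
      simp only [hw, ha, bracket_smul_smul]
    have hne : ∀ j k, j ≠ k → bracket (D.vertex i j).1.rep (D.vertex i k).1.rep ≠ 0 :=
      fun j k h => bracket_rep_ne_zero fun e => h (D.vertex_injective i (Subtype.ext e))
    apply wedge_oneSub_eq_sum
    · intro j k h
      rw [hb]
      exact mul_ne_zero (mul_ne_zero (ha0 j) (ha0 k)) (hne j k h)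
    · have h30 := hne 3 0 (by decide)
      have h21 := hne 2 1 (by decide)
      have := ha0 0
      have := ha0 1
      have := ha0 2
      have := ha0 3
      -- Each scalar `a k` occurs once in the numerator and once in the denominator, so the
      -- cross-ratio is unaffected by the change of representatives.
      simp only [hb, shape, crossRatio]
      field_simp
  have hs : ∀ i f, Equiv.Perm.sign (T.perm i f) = -1 := T.sign_perm
  have h13 : Equiv.Perm.sign (Equiv.swap (1 : Fin 4) 3) = -1 := Equiv.Perm.sign_swap (by decide)
  have s0 : Equiv.swap (1 : Fin 4) 3 0 = 0 := by decide
  have s1 : Equiv.swap (1 : Fin 4) 3 1 = 3 := by decide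
  have s2 : Equiv.swap (1 : Fin 4) 3 2 = 2 := by decide
  have s3 : Equiv.swap (1 : Fin 4) 3 3 = 1 := by decide
  rw [blochSum, Finset.sum_congr rfl fun i _ => hshape i, Finset.sum_neg_distrib,
    ← Fintype.sum_prod_type' (f := fun i (t : alternatingGroup (Fin 4)) =>
      cornerWedge (w i (t.1 1)) (w i (t.1 2)) (w i (t.1 3))), neg_eq_zero]
  -- The corner `(i, t)` is matched with its image under the gluing of the face `t 0`. Since the
  -- gluing permutation is odd, composing with the swap of `1` and `3` restores evenness; it
  -- reverses the corner and keeps its middle vertex.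
  refine Finset.sum_involution
    (fun x _ => (T.next x.1 (x.2.1 0),
      ⟨T.perm x.1 (x.2.1 0) * x.2.1 * Equiv.swap 1 3, by
        rw [Equiv.Perm.mem_alternatingGroup, map_mul, map_mul, hs, h13,
          Equiv.Perm.mem_alternatingGroup.1 x.2.2]
        rfl⟩)) ?_ ?_ (fun _ _ => Finset.mem_univ _) ?_
  · rintro ⟨i, t, ht⟩ -
    obtain ⟨g, hg⟩ := D.exists_mulVec_vertex hu i (t 0)
    have hn : ∀ j : Fin 4, j ≠ 0 → t j ≠ t 0 := fun j hj => t.injective.ne hj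
    simp only [Equiv.Perm.mul_apply, s1, s2, s3]
    rw [cornerWedge_mulVec g (hg (t 3) (hn 3 (by decide))) (hg (t 2) (hn 2 (by decide)))
      (hg (t 1) (hn 1 (by decide))), cornerWedge_reverse]
    exact neg_add_cancel _
  -- A fixed corner would lie on a face glued to itself.
  · rintro ⟨i, t, ht⟩ - - h
    apply T.ne_self i (t 0)
    rw [Prod.mk.injEq] at h
    have h2 := congrArg (fun s : alternatingGroup (Fin 4) => s.1 0) h.2
    simp only [Equiv.Perm.mul_apply, s0] at h2
    exact Prod.ext h.1 h2
  · rintro ⟨i, t, ht⟩ -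
    refine Prod.ext ?_ (Subtype.ext ?_)
    · simp only [Equiv.Perm.mul_apply, s0]
      exact T.next_next i (t 0)
    · simp only [Equiv.Perm.mul_apply, s0]
      rw [T.perm_perm i (t 0), mul_assoc, mul_assoc, mul_assoc, Equiv.swap_mul_self, mul_one,
        inv_mul_cancel_left]

theorem delta_beta [Fintype ι] : delta ℂ D.beta = D.blochSum := by
  rw [beta, blochSum, map_sum]
  refine Finset.sum_congr rfl fun i _ => ?_
  change FreeAbelianGroup.lift _ (FreeAbelianGroup.of (D.shape i)) = _
  rw [FreeAbelianGroup.lift_apply_of]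

end Development

end BlochHyp

end

theorem mainTheorem10 (Γ : Subgroup BlochHyp.PSL2) (hΓ : BlochHyp.IsFiniteVolume Γ)
    {ι : Type*} [Fintype ι] (T : BlochHyp.IdealTriangulation Γ ι) (D : BlochHyp.Development T) :
    D.blochSum = 0 ∧ D.beta ∈ BlochHyp.Bloch ℂ := by
  have h := D.blochSum_eq_zero hΓ
  exact ⟨h, (AddMonoidHom.mem_ker).2 (D.delta_beta.trans h)⟩
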